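/- Let $a \ge 0$ and $b > 0$ be real numbers, and let $\Omega \subset \mathbb{R}^3$ be the solid oblique circular cylinder defined as the convex hull of the two parallel disks $$\{(x,y,z) : x^2+y^2 \le 1,\ z = 0\} \quad\text{and}\quad \{(x,y,z) : x^2+(y-a)^2 \le 1,\ z = b\}.$$ Then the volume of $\Omega$ is $\pi b$, and its total surface area (the area, i.e. two-dimensional Hausdorff measure normalized to agree with Lebesgue area on planes, of the boundary $\partial\Omega$, bases included) is $$2\left(\pi + 2\sqrt{a^2+b^2}\; E\!\left(\frac{a^2}{a^2+b^2}\right)\right),$$ where $$E(\mu) = \int_0^{\pi/2} \sqrt{1-\mu \sin^2\theta}\; d\theta \qquad (0 \le \mu \le 1)$$ is the complete elliptic integral of the second kind in terms of the parameter $\mu = k^2$. -/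

import Mathlib

open scoped Real MeasureTheory

noncomputable section

/-- The unit disk `x² + y² ≤ 1` in the plane `z = 0` of `ℝ³`. -/
def bottomDisk : Set (EuclideanSpace ℝ (Fin 3)) :=
  {p | p 0 ^ 2 + p 1 ^ 2 ≤ 1 ∧ p 2 = 0}

/-- The unit disk `x² + (y - a)² ≤ 1` in the plane `z = b` of `ℝ³`. -/
def topDisk (a b : ℝ) : Set (EuclideanSpace ℝ (Fin 3)) :=
  {p | p 0 ^ 2 + (p 1 - a) ^ 2 ≤ 1 ∧ p 2 = b}

/-- The solid oblique circular cylinder: the convex hull of the two parallel disks. -/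
def obliqueCylinder (a b : ℝ) : Set (EuclideanSpace ℝ (Fin 3)) :=
  convexHull ℝ (bottomDisk ∪ topDisk a b)

/-- Total surface area of a solid in `ℝ³`: the two-dimensional Hausdorff measure of its
topological boundary, in the normalization that agrees with Lebesgue area on planes. -/
def surfaceArea (S : Set (EuclideanSpace ℝ (Fin 3))) : ENNReal :=
  μHE[2] (frontier S)

/-- The complete elliptic integral of the second kind, as a function of the parameter `m = k²`
(used for `m ≤ 1`). -/
def ellipticE (m : ℝ) : ℝ :=
  ∫ θ in (0 : ℝ)..(π / 2), √(1 - m * Real.sin θ ^ 2)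

end

open MeasureTheory Set

/-! Shearing by slope `a / b` straightens the solid into (unit disk) × `[0, b]`. Horizontal slices
are thus unit disks, and integrating their area `π` over the height gives the volume. The boundary
splits disjointly into two unit disks and an open lateral surface.

The lateral surface is the image of (angle, height) under `lateralMap`, whose area density at angle
`θ` is `√(b² + a² sin² θ)`. On a strip of angular width `h` the map differs from its linearization
by a relative error `O(h)`, so each is Lipschitz relative to the other with constant `1 + O(h)`. The
strip's area is therefore density times `h`, up to `O(h²)`. Hence the area swept up to angle `s` is
a primitive of the density, and symmetry reduces the full integral to four quarter periods of `E`.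
-/

/-- A map that is Lipschitz relative to another one increases Hausdorff measures of images
at most by the corresponding power of the constant. -/
theorem euclideanHausdorffMeasure_image_le_of_edist_le {X Y Z : Type*}
    [EMetricSpace Y] [MeasurableSpace Y] [BorelSpace Y]
    [EMetricSpace Z] [MeasurableSpace Z] [BorelSpace Z]
    {f : X → Y} {g : X → Z} {s : Set X} {K : NNReal} (d : ℕ)
    (h : ∀ p ∈ s, ∀ q ∈ s, edist (f p) (f q) ≤ K * edist (g p) (g q)) :
    μHE[d] (f '' s) ≤ (K : ENNReal) ^ d * μHE[d] (g '' s) := by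
  rcases s.eq_empty_or_nonempty with rfl | ⟨x₀, -⟩
  · simp
  have : Nonempty X := ⟨x₀⟩
  -- Points with equal `g` have equal `f` on `s`, so `f` factors through `g`; any section `φ` of `g`
  -- realizes this, and `g` need not be injective.
  set φ : Z → X := Function.invFunOn g s with hφ
  have hφs : ∀ z ∈ g '' s, φ z ∈ s := fun z hz => Function.invFunOn_mem hz
  have hφg : ∀ z ∈ g '' s, g (φ z) = z := fun z hz => Function.invFunOn_eq hz
  have himage : f '' s = (f ∘ φ) '' (g '' s) := by
    rw [image_image]
    refine image_congr fun p hp => ?_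
    have hz : g p ∈ g '' s := mem_image_of_mem g hp
    have := h p hp _ (hφs _ hz)
    rw [hφg _ hz, edist_self, mul_zero] at this
    exact edist_eq_zero.mp (le_antisymm this bot_le)
  have hlip : LipschitzOnWith K (f ∘ φ) (g '' s) := by
    intro z hz w hw
    have := h _ (hφs z hz) _ (hφs w hw)
    rwa [hφg z hz, hφg w hw] at this
  have key := hlip.hausdorffMeasure_image_le (d := d) (by positivity)
  rw [← himage, ENNReal.rpow_natCast] at key
  simp_rw [Measure.euclideanHausdorffMeasure_def, Measure.smul_apply, ENNReal.smul_def,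
    smul_eq_mul]
  calc _ ≤ _ := mul_le_mul_right key _
    _ = _ := mul_left_comm _ _ _

/-! ### Lateral surface: parametrization and linearization -/

/-- The parametrization of the lateral surface of the oblique cylinder. -/
noncomputable def lateralMap (a b : ℝ) (p : EuclideanSpace ℝ (Fin 2)) :
    EuclideanSpace ℝ (Fin 3) :=
  !₂[Real.cos (p 0), Real.sin (p 0) + a * p 1, b * p 1]

/-- The derivative of `lateralMap` at a point of angle `θ`. -/
noncomputable def lateralDeriv (a b θ : ℝ) :
    EuclideanSpace ℝ (Fin 2) →ₗ[ℝ] EuclideanSpace ℝ (Fin 3) where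
  toFun p := !₂[-Real.sin θ * p 0, Real.cos θ * p 0 + a * p 1, b * p 1]
  map_add' p q := by
    ext i; fin_cases i <;> simp <;> ring
  map_smul' c p := by
    ext i; fin_cases i <;> simp <;> ring

/-- The area density of `lateralMap` at angle `θ`. -/
noncomputable def lateralDensity (a b θ : ℝ) : ℝ := √(b ^ 2 + a ^ 2 * Real.sin θ ^ 2)

theorem lateralDensity_nonneg (a b θ : ℝ) : 0 ≤ lateralDensity a b θ := Real.sqrt_nonneg _

theorem normDet_lateralDeriv (a b θ : ℝ) :
    (lateralDeriv a b θ).normDet = lateralDensity a b θ := by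
  rw [lateralDensity, ← sq_eq_sq₀ (LinearMap.normDet_nonneg _) (Real.sqrt_nonneg _),
    Real.sq_sqrt (by positivity)]
  -- The columns have squared lengths `1` and `a² + b²`, and inner product `a cos θ`.
  have h := (lateralDeriv a b θ).normDet_sq_eq_det_gram (EuclideanSpace.basisFun (Fin 2) ℝ)
  simp only [RCLike.ofReal_real_eq_id, id] at h
  rw [h, Matrix.det_fin_two]
  simp [Matrix.gram, lateralDeriv, PiLp.inner_apply, Fin.sum_univ_three]
  linear_combination (a^2+b^2) * Real.sin_sq_add_cos_sq θ - a^2 * Real.sin_sq_add_cos_sq θ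

/-- The rectangle `[x, y) × (0, 1)`. -/
def strip (x y : ℝ) : Set (EuclideanSpace ℝ (Fin 2)) := {p | p 0 ∈ Ico x y ∧ p 1 ∈ Ioo 0 1}

theorem measurableSet_strip (x y : ℝ) : MeasurableSet (strip x y) := by
  unfold strip
  measurability

theorem volume_strip (x y : ℝ) : volume (strip x y) = ENNReal.ofReal (y - x) := by
  have h : strip x y = WithLp.ofLp ⁻¹' (univ.pi ![Ico x y, Ioo (0 : ℝ) 1]) := by
    ext p
    simp [strip, Set.mem_pi, Fin.forall_fin_two]
  rw [h, (PiLp.volume_preserving_ofLp (Fin 2)).measure_preimage]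
  · simp [volume_pi_pi]
  · refine (MeasurableSet.univ_pi fun i => ?_).nullMeasurableSet
    fin_cases i <;> simp

theorem area_lateralDeriv_strip (a b θ x y : ℝ) :
    μHE[2] (lateralDeriv a b θ '' strip x y) =
      ENNReal.ofReal (lateralDensity a b θ * (y - x)) := by
  have h := (lateralDeriv a b θ).euclideanHausdorffMeasure_image_eq_normDet_mul_volume (strip x y)
  rw [finrank_euclideanSpace_fin] at h
  rw [h, normDet_lateralDeriv, volume_strip, ENNReal.ofReal_mul (lateralDensity_nonneg a b θ)]

theorem lateralDeriv_lower_bound {a b : ℝ} (hb : 0 < b) (θ : ℝ)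
    (p : EuclideanSpace ℝ (Fin 2)) :
    b / √(a ^ 2 + b ^ 2) * |p 0| ≤ ‖lateralDeriv a b θ p‖ := by
  rw [EuclideanSpace.norm_eq]
  apply Real.le_sqrt_of_sq_le
  rw [mul_pow, div_pow, Real.sq_sqrt (by positivity), sq_abs, div_mul_eq_mul_div,
    div_le_iff₀ (by positivity)]
  simp [lateralDeriv, Fin.sum_univ_three]
  have h := Real.sin_sq_add_cos_sq θ
  have h1 : Real.sin θ ^ 2 = 1 - Real.cos θ ^ 2 := by linarith
  -- Complete the square in `p 1`, the coordinate to be eliminated.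
  have : ((Real.sin θ * p 0) ^ 2 + (Real.cos θ * p 0 + a * p 1) ^ 2 + (b * p 1) ^ 2) *
      (a ^ 2 + b ^ 2) - b ^ 2 * p 0 ^ 2 =
      a ^ 2 * (Real.sin θ * p 0) ^ 2 + ((a ^ 2 + b ^ 2) * p 1 + a * Real.cos θ * p 0) ^ 2 := by
    simp only [mul_pow, h1]
    ring
  nlinarith [sq_nonneg (a * (Real.sin θ * p 0)),
    sq_nonneg ((a ^ 2 + b ^ 2) * p 1 + a * Real.cos θ * p 0)]

/-- Mean value inequality for `cos` and `sin` minus their linear parts with slope taken at `ψ`. -/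
theorem abs_trig_remainder_le {x y θ φ ψ : ℝ} (hθ : θ ∈ Icc x y) (hφ : φ ∈ Icc x y)
    (hψ : ψ ∈ Icc x y) :
    |Real.cos θ - Real.cos φ + Real.sin ψ * (θ - φ)| ≤ (y - x) * |θ - φ| ∧
    |Real.sin θ - Real.sin φ - Real.cos ψ * (θ - φ)| ≤ (y - x) * |θ - φ| := by
  constructor
  · have := (convex_Icc x y).norm_image_sub_le_of_norm_hasDerivWithin_le
      (f := fun t => Real.cos t + Real.sin ψ * t) (f' := fun t => - Real.sin t + Real.sin ψ)
      (C := y - x) (fun t _ => by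
        have := (Real.hasDerivAt_cos t).add ((hasDerivAt_id t).const_mul (Real.sin ψ))
        simpa [Function.comp_def, Pi.add_def, Pi.sub_def] using this.hasDerivWithinAt) (fun t ht => by
        have h1 : |Real.sin ψ - Real.sin t| ≤ |ψ - t| := by
          simpa [Real.dist_eq] using Real.lipschitzWith_sin.dist_le_mul ψ t
        have h2 : |ψ - t| ≤ y - x := abs_sub_le_of_le_of_le hψ.1 hψ.2 ht.1 ht.2
        rw [Real.norm_eq_abs, neg_add_eq_sub]
        exact h1.trans h2) hφ hθ
    rw [Real.norm_eq_abs, Real.norm_eq_abs] at this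
    convert! this using 2
    ring
  · have := (convex_Icc x y).norm_image_sub_le_of_norm_hasDerivWithin_le
      (f := fun t => Real.sin t - Real.cos ψ * t) (f' := fun t => Real.cos t - Real.cos ψ)
      (C := y - x) (fun t _ => by
        have := (Real.hasDerivAt_sin t).sub ((hasDerivAt_id t).const_mul (Real.cos ψ))
        simpa [Function.comp_def, Pi.add_def, Pi.sub_def] using this.hasDerivWithinAt) (fun t ht => by
        have h1 : |Real.cos t - Real.cos ψ| ≤ |t - ψ| := by
          simpa [Real.dist_eq] using Real.lipschitzWith_cos.dist_le_mul t ψ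
        have h2 : |t - ψ| ≤ y - x := abs_sub_le_of_le_of_le ht.1 ht.2 hψ.1 hψ.2
        rw [Real.norm_eq_abs]
        exact h1.trans h2) hφ hθ
    rw [Real.norm_eq_abs, Real.norm_eq_abs] at this
    convert! this using 2
    ring

/-- The map is affine in height, so the remainder involves only the angle difference, which
`lateralDeriv_lower_bound` controls. Measuring the error against the linear map itself yields
relative Lipschitz constants. -/
theorem norm_lateralMap_sub_le {a b x y : ℝ} (hb : 0 < b)
    {p q : EuclideanSpace ℝ (Fin 2)} (hp : p ∈ strip x y) (hq : q ∈ strip x y) :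
    ‖lateralMap a b p - lateralMap a b q - lateralDeriv a b x (p - q)‖ ≤
      2 * √(a ^ 2 + b ^ 2) / b * (y - x) * ‖lateralDeriv a b x (p - q)‖ := by
  have hx : x ∈ Icc x y := ⟨le_rfl, (hp.1.1.trans_lt hp.1.2).le⟩
  obtain ⟨h1, h2⟩ := abs_trig_remainder_le (Ico_subset_Icc_self hp.1) (Ico_subset_Icc_self hq.1) hx
  have hxy : 0 ≤ y - x := sub_nonneg.mpr hx.2
  have hs : 0 < √(a ^ 2 + b ^ 2) := Real.sqrt_pos.mpr (by positivity)
  have h3 : ‖lateralMap a b p - lateralMap a b q - lateralDeriv a b x (p - q)‖ ≤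
      2 * ((y - x) * |p 0 - q 0|) := by
    rw [EuclideanSpace.norm_eq]
    apply Real.sqrt_le_iff.mpr ⟨by positivity, ?_⟩
    have e1 := sq_le_sq' (abs_le.mp h1).1 (abs_le.mp h1).2
    have e2 := sq_le_sq' (abs_le.mp h2).1 (abs_le.mp h2).2
    simp [lateralDeriv, lateralMap, Fin.sum_univ_three]
    have e3 : Real.sin (p 0) + a * p 1 - (Real.sin (q 0) + a * q 1) -
        (Real.cos x * (p 0 - q 0) + a * (p 1 - q 1)) =
        Real.sin (p 0) - Real.sin (q 0) - Real.cos x * (p 0 - q 0) := by ring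
    have e4 : b * p 1 - b * q 1 - b * (p 1 - q 1) = 0 := by ring
    rw [e3, e4]
    nlinarith [sq_nonneg ((y - x) * |p 0 - q 0|)]
  have h4 := lateralDeriv_lower_bound (a := a) hb x (p - q)
  have h5 : |p 0 - q 0| ≤ √(a ^ 2 + b ^ 2) / b * ‖lateralDeriv a b x (p - q)‖ := by
    rw [div_mul_eq_mul_div, le_div_iff₀ hb]
    rw [div_mul_eq_mul_div, div_le_iff₀ hs] at h4
    simp only [PiLp.sub_apply] at h4
    linarith
  calc _ ≤ _ := h3
    _ ≤ 2 * ((y - x) * (√(a ^ 2 + b ^ 2) / b * ‖lateralDeriv a b x (p - q)‖)) := by gcongr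
    _ = _ := by ring

/-! ### From strip estimates to the area integral -/

/-- A function whose increments agree with those of a linear approximation up to a quadratic error
is a primitive of the slopes. -/
theorem integral_eq_sub_of_abs_sub_le_sq {G D : ℝ → ℝ} {u v M K δ : ℝ} (huv : u ≤ v) (hδ : 0 < δ)
    (hM : 0 ≤ M) (hD : Continuous D) (hK : ∀ x, |D x| ≤ K)
    (h : ∀ x y, u ≤ x → x ≤ y → y ≤ v → y - x < δ → |G y - G x - D x * (y - x)| ≤ M * (y - x) ^ 2) :
    ∫ t in u..v, D t = G v - G u := by
  have hstep : ∀ x y, u ≤ x → x ≤ y → y ≤ v → y - x < δ →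
      |G y - G x| ≤ (K + M * δ) * (y - x) := by
    intro x y hux hxy hyv hyx
    have h0 : 0 ≤ y - x := sub_nonneg.mpr hxy
    have h1 := h x y hux hxy hyv hyx
    have h2 : |D x * (y - x)| ≤ K * (y - x) := by
      rw [abs_mul, abs_of_nonneg h0]
      exact mul_le_mul_of_nonneg_right (hK x) h0
    have h3 : M * (y - x) ^ 2 ≤ M * δ * (y - x) := by
      rw [sq, mul_assoc]
      gcongr
    have h4 := abs_add_le (G y - G x - D x * (y - x)) (D x * (y - x))
    rw [sub_add_cancel] at h4
    linarith
  -- Slopes are taken at left endpoints, so only right derivatives are at hand; they suffice once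
  -- `hstep` gives continuity.
  refine intervalIntegral.integral_eq_sub_of_hasDeriv_right_of_le huv ?_ ?_
    (hD.intervalIntegrable _ _)
  · intro x hx
    rw [ContinuousWithinAt, tendsto_iff_dist_tendsto_zero]
    have hlim : Filter.Tendsto (fun y => (K + M * δ) * |y - x|) (nhdsWithin x (Icc u v))
        (nhds 0) := by
      have : Continuous fun y => (K + M * δ) * |y - x| := by fun_prop
      simpa using (this.tendsto x).mono_left nhdsWithin_le_nhds
    refine squeeze_zero' (Filter.Eventually.of_forall fun _ => dist_nonneg) ?_ hlim
    filter_upwards [self_mem_nhdsWithin, mem_nhdsWithin_of_mem_nhds (Metric.ball_mem_nhds x hδ)]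
      with y hy hyx
    rw [Metric.mem_ball, Real.dist_eq] at hyx
    rw [Real.dist_eq]
    rcases le_total x y with hxy | hxy
    · rw [abs_of_nonneg (sub_nonneg.mpr hxy)] at hyx ⊢
      exact hstep x y hx.1 hxy hy.2 hyx
    · rw [abs_sub_comm y, abs_of_nonneg (sub_nonneg.mpr hxy)] at hyx
      rw [abs_sub_comm, abs_sub_comm y, abs_of_nonneg (sub_nonneg.mpr hxy)]
      exact hstep y x hy.1 hxy hx.2 hyx
  · intro x hx
    rw [hasDerivWithinAt_iff_isLittleO]
    have hO : (fun y => G y - G x - (y - x) • D x) =O[nhdsWithin x (Ioi x)]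
        fun y => (y - x) ^ 2 := by
      refine Asymptotics.IsBigO.of_bound M ?_
      filter_upwards [self_mem_nhdsWithin,
        mem_nhdsWithin_of_mem_nhds (Metric.ball_mem_nhds x hδ),
        mem_nhdsWithin_of_mem_nhds (Iio_mem_nhds hx.2)] with y hxy hyx hyv
      rw [Metric.mem_ball, Real.dist_eq, abs_of_pos (sub_pos.mpr hxy)] at hyx
      have := h x y hx.1.le (le_of_lt hxy) (le_of_lt hyv) hyx
      rw [Real.norm_eq_abs, Real.norm_eq_abs, abs_of_nonneg (sq_nonneg (y - x)), smul_eq_mul,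
        mul_comm (y - x)]
      exact this
    refine hO.trans_isLittleO ?_
    have h1 : (fun y : ℝ => y - x) =o[nhdsWithin x (Ioi x)] fun _ => (1 : ℝ) := by
      rw [Asymptotics.isLittleO_one_iff]
      have : Continuous fun y : ℝ => y - x := by fun_prop
      simpa using (this.tendsto x).mono_left (nhdsWithin_le_nhds (s := Ioi x))
    simpa [sq] using h1.mul_isBigO (Asymptotics.isBigO_refl (fun y : ℝ => y - x) _)

theorem area_lateralMap_strip_le {a b x y : ℝ} (hb : 0 < b) (hxy : x ≤ y) :
    μHE[2] (lateralMap a b '' strip x y) ≤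
      ENNReal.ofReal ((1 + 2 * √(a ^ 2 + b ^ 2) / b * (y - x)) ^ 2 *
        (lateralDensity a b x * (y - x))) := by
  set ε := 2 * √(a ^ 2 + b ^ 2) / b * (y - x) with hε
  have hε0 : 0 ≤ ε := mul_nonneg (by positivity) (sub_nonneg.mpr hxy)
  have h := euclideanHausdorffMeasure_image_le_of_edist_le (f := lateralMap a b)
    (g := lateralDeriv a b x) (s := strip x y) (K := (1 + ε).toNNReal) 2 (by
      intro p hp q hq
      change _ ≤ ENNReal.ofReal _ * _
      rw [edist_dist, edist_dist, ← ENNReal.ofReal_mul (by positivity)]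
      refine ENNReal.ofReal_le_ofReal ?_
      rw [dist_eq_norm, dist_eq_norm, ← map_sub]
      have h1 := norm_lateralMap_sub_le (a := a) hb hp hq
      have h2 := norm_le_norm_add_norm_sub' (lateralMap a b p - lateralMap a b q)
        (lateralDeriv a b x (p - q))
      linarith)
  refine h.trans_eq ?_
  rw [area_lateralDeriv_strip, ENNReal.ofReal_mul (p := (1 + ε) ^ 2) (by positivity),
    ENNReal.ofReal_pow (by positivity)]
  rfl

theorem le_area_lateralMap_strip {a b x y : ℝ} (hb : 0 < b)
    (h1 : 2 * √(a ^ 2 + b ^ 2) / b * (y - x) < 1) :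
    ENNReal.ofReal ((1 - 2 * √(a ^ 2 + b ^ 2) / b * (y - x)) ^ 2 *
        (lateralDensity a b x * (y - x))) ≤ μHE[2] (lateralMap a b '' strip x y) := by
  set ε := 2 * √(a ^ 2 + b ^ 2) / b * (y - x) with hε
  have h1' : 0 < 1 - ε := sub_pos.mpr h1
  have h := euclideanHausdorffMeasure_image_le_of_edist_le (g := lateralMap a b)
    (f := lateralDeriv a b x) (s := strip x y) (K := (1 - ε)⁻¹.toNNReal) 2 (by
      intro p hp q hq
      change _ ≤ ENNReal.ofReal _ * _
      rw [edist_dist, edist_dist, ← ENNReal.ofReal_mul (by positivity)]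
      refine ENNReal.ofReal_le_ofReal ?_
      rw [dist_eq_norm, dist_eq_norm, ← map_sub, inv_mul_eq_div, le_div_iff₀ h1']
      have h1 := norm_lateralMap_sub_le (a := a) hb hp hq
      have h2 := norm_le_norm_add_norm_sub (lateralMap a b p - lateralMap a b q)
        (lateralDeriv a b x (p - q))
      linarith)
  rw [area_lateralDeriv_strip] at h
  rw [ENNReal.ofReal_mul (by positivity)]
  refine (mul_le_mul_right h _).trans_eq ?_
  change _ * (ENNReal.ofReal _ ^ 2 * _) = _
  rw [← mul_assoc, ← ENNReal.ofReal_pow (by positivity), ← ENNReal.ofReal_mul (by positivity),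
    ← mul_pow, mul_inv_cancel₀ h1'.ne']
  simp

theorem area_lateralMap_strip_ne_top {a b x y : ℝ} (hb : 0 < b) (hxy : x ≤ y) :
    μHE[2] (lateralMap a b '' strip x y) ≠ ⊤ :=
  ((area_lateralMap_strip_le hb hxy).trans_lt ENNReal.ofReal_lt_top).ne

theorem lateralDensity_le (a b θ : ℝ) : lateralDensity a b θ ≤ √(a ^ 2 + b ^ 2) := by
  apply Real.sqrt_le_sqrt
  nlinarith [Real.sin_sq_le_one θ, sq_nonneg a]

/-- With `ε < 1`, both `(1 + ε)² - 1` and `1 - (1 - ε)²` are at most `3ε`, whence the factor `3`. -/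
theorem abs_area_lateralMap_strip_sub_le {a b x y : ℝ} (hb : 0 < b) (hxy : x ≤ y)
    (h1 : 2 * √(a ^ 2 + b ^ 2) / b * (y - x) < 1) :
    |(μHE[2] (lateralMap a b '' strip x y)).toReal - lateralDensity a b x * (y - x)| ≤
      3 * (2 * √(a ^ 2 + b ^ 2) / b) * √(a ^ 2 + b ^ 2) * (y - x) ^ 2 := by
  have hyx : 0 ≤ y - x := sub_nonneg.mpr hxy
  have hU := ENNReal.toReal_mono ENNReal.ofReal_ne_top (area_lateralMap_strip_le (a := a) hb hxy)
  have hL := ENNReal.toReal_mono (area_lateralMap_strip_ne_top hb hxy)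
    (le_area_lateralMap_strip hb h1)
  have hD := lateralDensity_nonneg a b x
  have hD' := lateralDensity_le a b x
  rw [ENNReal.toReal_ofReal (by positivity)] at hU hL
  set ε := 2 * √(a ^ 2 + b ^ 2) / b * (y - x) with hε
  have hε0 : 0 ≤ ε := by positivity
  set d := lateralDensity a b x * (y - x) with hd
  have hd0 : 0 ≤ d := by positivity
  have hdS : d ≤ √(a ^ 2 + b ^ 2) * (y - x) := mul_le_mul_of_nonneg_right hD' hyx
  have hgoal : 3 * ε * d ≤
      3 * (2 * √(a ^ 2 + b ^ 2) / b) * √(a ^ 2 + b ^ 2) * (y - x) ^ 2 := by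
    calc 3 * ε * d ≤ 3 * ε * (√(a ^ 2 + b ^ 2) * (y - x)) := by gcongr
      _ = _ := by rw [hε]; ring
  have hsq : ε ^ 2 * d ≤ ε * d := by gcongr; nlinarith
  have hεd : 0 ≤ ε ^ 2 * d := by positivity
  rw [abs_le]
  constructor <;> nlinarith

theorem continuous_lateralMap (a b : ℝ) : Continuous (lateralMap a b) := by
  unfold lateralMap
  refine (PiLp.continuous_toLp 2 _).comp (continuous_pi fun i => ?_)
  fin_cases i <;> simp <;> fun_prop

theorem eq_of_cos_eq_of_sin_eq {θ φ : ℝ} (hθ : θ ∈ Ico 0 (2 * π)) (hφ : φ ∈ Ico 0 (2 * π))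
    (hc : Real.cos θ = Real.cos φ) (hs : Real.sin θ = Real.sin φ) : θ = φ := by
  obtain ⟨n, hn⟩ := Real.Angle.angle_eq_iff_two_pi_dvd_sub.mp (Real.Angle.cos_sin_inj hc hs)
  have hπ := Real.pi_pos
  have h1 : (n : ℝ) < 1 := by nlinarith [hθ.1, hθ.2, hφ.1, hφ.2]
  have h2 : (-1 : ℝ) < n := by nlinarith [hθ.1, hθ.2, hφ.1, hφ.2]
  have : n = 0 := by
    have h1' : n < 1 := by exact_mod_cast h1
    have h2' : -1 < n := by exact_mod_cast h2
    omega
  subst this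
  simpa [sub_eq_zero] using hn

theorem injOn_lateralMap {a b : ℝ} (hb : b ≠ 0) : InjOn (lateralMap a b) (strip 0 (2 * π)) := by
  intro p hp q hq h
  have h0 : Real.cos (p 0) = Real.cos (q 0) := by simpa [lateralMap] using congr($h 0)
  have h1 : Real.sin (p 0) + a * p 1 = Real.sin (q 0) + a * q 1 := by
    simpa [lateralMap] using congr($h 1)
  have h2 : p 1 = q 1 := by simpa [lateralMap, hb] using congr($h 2)
  have h3 : p 0 = q 0 := eq_of_cos_eq_of_sin_eq hp.1 hq.1 h0 (by rw [h2] at h1; linarith)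
  ext i
  fin_cases i
  · exact h3
  · exact h2

theorem strip_mono {x y x' y' : ℝ} (hx : x' ≤ x) (hy : y ≤ y') : strip x y ⊆ strip x' y' :=
  fun _ hp => ⟨Ico_subset_Ico hx hy hp.1, hp.2⟩

theorem area_lateralMap_strip_add {a b x y : ℝ} (hb : b ≠ 0) (hx : 0 ≤ x) (hxy : x ≤ y)
    (hy : y ≤ 2 * π) :
    μHE[2] (lateralMap a b '' strip 0 y) =
      μHE[2] (lateralMap a b '' strip 0 x) + μHE[2] (lateralMap a b '' strip x y) := by
  have hunion : strip 0 y = strip 0 x ∪ strip x y := by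
    ext p
    simp only [strip, mem_ofPred_eq, mem_union, ← or_and_right, ← Ico_union_Ico_eq_Ico hx hxy]
  have hdisj : Disjoint (strip 0 x) (strip x y) :=
    disjoint_left.mpr fun p hp hq => (hp.1.2.trans_le hq.1.1).false
  rw [hunion, image_union, measure_union]
  · exact hdisj.image (injOn_lateralMap hb) (strip_mono le_rfl (hxy.trans hy)) (strip_mono hx hy)
  · exact (measurableSet_strip x y).image_of_continuousOn_injOn
      (continuous_lateralMap a b).continuousOn ((injOn_lateralMap hb).mono (strip_mono hx hy))

theorem continuous_lateralDensity (a b : ℝ) : Continuous (lateralDensity a b) := by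
  unfold lateralDensity
  fun_prop

theorem area_lateralMap_strip_eq_integral {a b : ℝ} (hb : 0 < b) :
    μHE[2] (lateralMap a b '' strip 0 (2 * π)) =
      ENNReal.ofReal (∫ θ in (0 : ℝ)..(2 * π), lateralDensity a b θ) := by
  have hS : 0 < √(a ^ 2 + b ^ 2) := Real.sqrt_pos.mpr (by positivity)
  have hC : 0 < 2 * √(a ^ 2 + b ^ 2) / b := by positivity
  -- This `δ` is the width below which the relative error `ε` stays under `1`.
  rw [integral_eq_sub_of_abs_sub_le_sq (δ := (2 * √(a ^ 2 + b ^ 2) / b)⁻¹)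
    (K := √(a ^ 2 + b ^ 2)) (M := 3 * (2 * √(a ^ 2 + b ^ 2) / b) * √(a ^ 2 + b ^ 2))
    (G := fun s => (μHE[2] (lateralMap a b '' strip 0 s)).toReal) Real.two_pi_pos.le
    (by positivity) (by positivity) (continuous_lateralDensity a b)
    (fun x => by
      rw [abs_of_nonneg (lateralDensity_nonneg a b x)]; exact lateralDensity_le a b x)]
  · have : strip 0 0 = ∅ := by simp [strip]
    simp [this, ENNReal.ofReal_toReal (area_lateralMap_strip_ne_top hb Real.two_pi_pos.le)]
  · intro x y hx hxy hy hyx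
    beta_reduce
    rw [area_lateralMap_strip_add hb.ne' hx hxy hy,
      ENNReal.toReal_add (area_lateralMap_strip_ne_top hb hx) (area_lateralMap_strip_ne_top hb hxy),
      add_sub_cancel_left]
    refine abs_area_lateralMap_strip_sub_le hb hxy ?_
    rwa [← lt_inv_mul_iff₀ hC, mul_one]

theorem integral_lateralDensity {a b : ℝ} (hb : 0 < b) :
    ∫ θ in (0 : ℝ)..(2 * π), lateralDensity a b θ =
      4 * √(a ^ 2 + b ^ 2) * ellipticE (a ^ 2 / (a ^ 2 + b ^ 2)) := by
  have hint : ∀ u v, IntervalIntegrable (lateralDensity a b) volume u v :=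
    fun u v => (continuous_lateralDensity a b).intervalIntegrable u v
  set I := ∫ θ in (0 : ℝ)..(π / 2), lateralDensity a b θ with hI
  have h1 : ∫ θ in (π / 2)..π, lateralDensity a b θ = I := by
    have := intervalIntegral.integral_comp_sub_left (a := 0) (b := π / 2) (lateralDensity a b) π
    rw [sub_zero, sub_half] at this
    rw [← this, hI]
    simp [lateralDensity]
  have h2 : ∫ θ in π..(2 * π), lateralDensity a b θ = ∫ θ in (0 : ℝ)..π, lateralDensity a b θ := by
    have := intervalIntegral.integral_comp_add_right (a := 0) (b := π) (lateralDensity a b) π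
    rw [zero_add, ← two_mul] at this
    rw [← this]
    simp [lateralDensity]
  -- The substitution `θ ↦ π/2 - θ` turns `sin²` into `cos² = 1 - sin²`, so that `a² + b²` factors
  -- out.
  have h3 : I = √(a ^ 2 + b ^ 2) * ellipticE (a ^ 2 / (a ^ 2 + b ^ 2)) := by
    have := intervalIntegral.integral_comp_sub_left (a := 0) (b := π / 2) (lateralDensity a b)
      (π / 2)
    rw [sub_zero, sub_self] at this
    rw [hI, ← this, ellipticE, ← intervalIntegral.integral_const_mul]
    refine intervalIntegral.integral_congr fun θ _ => ?_
    rw [lateralDensity, Real.sin_pi_div_two_sub, ← Real.sqrt_mul (by positivity), Real.cos_sq']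
    congr 1
    field_simp
    ring
  rw [← intervalIntegral.integral_add_adjacent_intervals (hint 0 π) (hint π (2 * π)), h2,
    ← intervalIntegral.integral_add_adjacent_intervals (hint 0 (π / 2)) (hint (π / 2) π), h1, ← hI,
    h3]
  ring

/-! ### Straightening the solid; volume by slicing -/

/-- The linear equivalence that straightens a cylinder of slope `k` along the second axis, and
splits off the height. -/
noncomputable def shear (k : ℝ) :
    EuclideanSpace ℝ (Fin 3) ≃L[ℝ] EuclideanSpace ℝ (Fin 2) × ℝ :=
  LinearEquiv.toContinuousLinearEquiv
    { toFun := fun p => (!₂[p 0, p 1 - k * p 2], p 2)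
      invFun := fun x => !₂[x.1 0, x.1 1 + k * x.2, x.2]
      map_add' := fun p q => by
        refine Prod.ext ?_ (by simp)
        ext i
        fin_cases i <;> simp
        ring
      map_smul' := fun c p => by
        refine Prod.ext ?_ (by simp)
        ext i
        fin_cases i <;> simp
        ring
      left_inv := fun p => by
        ext i; fin_cases i <;> simp
      right_inv := fun x => by
        refine Prod.ext ?_ (by simp)
        ext i; fin_cases i <;> simp }

theorem shear_apply (k : ℝ) (p : EuclideanSpace ℝ (Fin 3)) :
    shear k p = (!₂[p 0, p 1 - k * p 2], p 2) := rfl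

theorem mem_closedBall_zero_one_iff (x : EuclideanSpace ℝ (Fin 2)) :
    x ∈ Metric.closedBall 0 1 ↔ x 0 ^ 2 + x 1 ^ 2 ≤ 1 := by
  simp [EuclideanSpace.norm_eq]

theorem mem_sphere_zero_one_iff (x : EuclideanSpace ℝ (Fin 2)) :
    x ∈ Metric.sphere 0 1 ↔ x 0 ^ 2 + x 1 ^ 2 = 1 := by
  simp [EuclideanSpace.norm_eq]

theorem obliqueCylinder_eq_preimage {a b : ℝ} (hb : 0 < b) :
    obliqueCylinder a b = shear (a / b) ⁻¹' (Metric.closedBall 0 1 ×ˢ Icc 0 b) := by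
  apply Subset.antisymm
  · refine convexHull_min (union_subset ?_ ?_) ?_
    · rintro p ⟨h1, h2⟩
      simp only [mem_preimage, shear_apply, mem_prod, mem_closedBall_zero_one_iff]
      simp [h1, h2, hb.le]
    · rintro p ⟨h1, h2⟩
      simp only [mem_preimage, shear_apply, mem_prod, mem_closedBall_zero_one_iff]
      simp [h1, h2, hb.le, div_mul_cancel₀ a hb.ne']
    · exact ((convex_closedBall 0 1).prod (convex_Icc 0 b)).linear_preimage
        (shear (a / b)).toLinearEquiv.toLinearMap
  · intro p hp
    simp only [mem_preimage, shear_apply, mem_prod, mem_closedBall_zero_one_iff] at hp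
    obtain ⟨h1, h2, h3⟩ := hp
    simp at h1
    -- The line through `p` parallel to the axis meets the two disks in these points.
    have hbot : !₂[p 0, p 1 - a / b * p 2, 0] ∈ bottomDisk := by simpa [bottomDisk] using h1
    have htop : !₂[p 0, p 1 - a / b * p 2 + a, b] ∈ topDisk a b := by simpa [topDisk] using h1
    refine segment_subset_convexHull (mem_union_left _ hbot) (mem_union_right _ htop)
      ⟨1 - p 2 / b, p 2 / b, ?_, ?_, by ring, ?_⟩
    · rw [sub_nonneg, div_le_one hb]; exact h3
    · exact div_nonneg h2 hb.le
    · ext i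
      fin_cases i <;> simp
      · ring
      · field_simp; ring
      · field_simp

/-- The embedding of the plane into space at height `d`, moved by `c` along the second axis. -/
noncomputable def liftPlane (c d : ℝ) (x : EuclideanSpace ℝ (Fin 2)) :
    EuclideanSpace ℝ (Fin 3) := !₂[x 0, x 1 + c, d]

theorem isometry_liftPlane (c d : ℝ) : Isometry (liftPlane c d) := by
  refine Isometry.of_dist_eq fun x y => ?_
  simp [EuclideanSpace.dist_eq, liftPlane, Fin.sum_univ_three]

theorem area_liftPlane_closedBall (c d : ℝ) :
    μHE[2] (liftPlane c d '' Metric.closedBall 0 1) = ENNReal.ofReal π := by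
  rw [(isometry_liftPlane c d).euclideanHausdorffMeasure_image,
    EuclideanSpace.euclideanHausdorffMeasure_eq_volume, EuclideanSpace.volume_closedBall_fin_two]
  simp [ENNReal.ofReal]

theorem liftPlane_image_closedBall (k d : ℝ) :
    liftPlane (k * d) d '' Metric.closedBall 0 1 =
      shear k ⁻¹' (Metric.closedBall 0 1 ×ˢ {d}) := by
  ext p
  constructor
  · rintro ⟨x, hx, rfl⟩
    rw [mem_closedBall_zero_one_iff] at hx
    simp only [mem_preimage, shear_apply, mem_prod, mem_closedBall_zero_one_iff]
    simpa [liftPlane] using hx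
  · rintro ⟨h1, h2⟩
    refine ⟨_, h1, ?_⟩
    obtain rfl : p 2 = d := h2
    ext i
    fin_cases i <;> simp [liftPlane, shear_apply]

theorem volume_obliqueCylinder {a b : ℝ} (hb : 0 < b) :
    volume (obliqueCylinder a b) = ENNReal.ofReal (π * b) := by
  rw [obliqueCylinder_eq_preimage hb]
  set e : EuclideanSpace ℝ (Fin 3) := EuclideanSpace.single 2 1 with he
  have he0 : e ≠ 0 := by simp [he]
  have hmeas : MeasurableSet (shear (a / b) ⁻¹' (Metric.closedBall 0 1 ×ˢ Icc 0 b)) :=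
    ((Metric.isClosed_closedBall.prod isClosed_Icc).preimage
      (shear (a / b)).continuous).measurableSet
  have h := EuclideanGeometry.euclideanHausdorffMeasure_eq_lintegral 0 he0 hmeas
  rw [finrank_euclideanSpace_fin, EuclideanSpace.euclideanHausdorffMeasure_eq_volume] at h
  have hslice : ∀ x : ℝ, shear (a / b) ⁻¹' (Metric.closedBall 0 1 ×ˢ Icc 0 b) ∩
      AffineSubspace.mk' (x • e +ᵥ (0 : EuclideanSpace ℝ (Fin 3))) (Submodule.span ℝ {e})ᗮ =
      if x ∈ Icc 0 b then liftPlane (a / b * x) x '' Metric.closedBall 0 1 else ∅ := by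
    intro x
    have hmem : ∀ p : EuclideanSpace ℝ (Fin 3),
        p ∈ AffineSubspace.mk' (x • e +ᵥ (0 : EuclideanSpace ℝ (Fin 3)))
          (Submodule.span ℝ {e})ᗮ ↔ p 2 = x := by
      intro p
      rw [AffineSubspace.mem_mk', Submodule.mem_orthogonal_singleton_iff_inner_right]
      rw [he, EuclideanSpace.inner_single_left]
      simp [sub_eq_zero]
    rw [liftPlane_image_closedBall]
    ext p
    simp only [mem_inter_iff, SetLike.mem_coe, hmem]
    split_ifs with hx
    · constructor
      · rintro ⟨⟨h1, h2⟩, h3⟩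
        exact ⟨h1, h3⟩
      · rintro ⟨h1, h2⟩
        obtain rfl : p 2 = x := h2
        exact ⟨⟨h1, hx⟩, rfl⟩
    · simp only [mem_empty_iff_false, iff_false]
      rintro ⟨⟨h1, h2⟩, rfl⟩
      exact hx h2
  have hint : ∀ x : ℝ, μHE[3 - 1] (shear (a / b) ⁻¹' (Metric.closedBall 0 1 ×ˢ Icc 0 b) ∩
      AffineSubspace.mk' (x • e +ᵥ (0 : EuclideanSpace ℝ (Fin 3))) (Submodule.span ℝ {e})ᗮ) =
      (Icc 0 b).indicator (fun _ => ENNReal.ofReal π) x := by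
    intro x
    rw [hslice, indicator]
    split_ifs
    · exact area_liftPlane_closedBall _ _
    · simp
  simp_rw [hint] at h
  rw [h, lintegral_indicator measurableSet_Icc, ENNReal.ofReal_mul Real.pi_pos.le]
  simp [he, enorm_eq_nnnorm]

/-! ### Decomposition of the boundary and total area -/

theorem exists_angle_of_sq_add_sq_eq_one {u v : ℝ} (h : u ^ 2 + v ^ 2 = 1) :
    ∃ θ ∈ Ico 0 (2 * π), Real.cos θ = u ∧ Real.sin θ = v := by
  set z : ℂ := ⟨u, v⟩
  have hz : ‖z‖ = 1 := by
    rw [Complex.norm_def, Complex.normSq_apply, Real.sqrt_eq_one, ← h]; ring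
  refine ⟨toIcoMod Real.two_pi_pos 0 z.arg, by
    simpa using toIcoMod_mem_Ico Real.two_pi_pos 0 z.arg, ?_, ?_⟩
  · rw [toIcoMod, Real.cos_periodic.sub_zsmul_eq,
      Complex.cos_arg (norm_ne_zero_iff.mp (by simp [hz])), hz, div_one]
  · rw [toIcoMod, Real.sin_periodic.sub_zsmul_eq, Complex.sin_arg, hz, div_one]

theorem lateralMap_image_strip {a b : ℝ} (hb : 0 < b) :
    lateralMap a b '' strip 0 (2 * π) = shear (a / b) ⁻¹' (Metric.sphere 0 1 ×ˢ Ioo 0 b) := by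
  ext p
  simp only [mem_preimage, shear_apply, mem_prod, mem_sphere_zero_one_iff]
  constructor
  · rintro ⟨x, ⟨hx, h0, h1⟩, rfl⟩
    refine ⟨?_, ?_, ?_⟩
    · have : a / b * (b * x 1) = a * x 1 := by field_simp
      simp [lateralMap, this]
    · simpa [lateralMap] using mul_pos hb h0
    · simpa [lateralMap] using mul_lt_of_lt_one_right hb h1
  · rintro ⟨h1, h2, h3⟩
    obtain ⟨θ, hθ, hc, hs⟩ := exists_angle_of_sq_add_sq_eq_one h1
    refine ⟨!₂[θ, p 2 / b], ⟨hθ, div_pos h2 hb, (div_lt_one hb).mpr h3⟩, ?_⟩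
    ext i
    fin_cases i
    · simpa [lateralMap] using hc
    · simp at hs
      simp [lateralMap, hs]
      ring
    · simp [lateralMap]
      field_simp

/-- The shear is a homeomorphism, so this is the frontier of a product. The rims are assigned to the
bases alone, making the three pieces disjoint. -/
theorem frontier_obliqueCylinder {a b : ℝ} (hb : 0 < b) :
    frontier (obliqueCylinder a b) =
      liftPlane (a / b * 0) 0 '' Metric.closedBall 0 1 ∪
        (liftPlane (a / b * b) b '' Metric.closedBall 0 1 ∪
          lateralMap a b '' strip 0 (2 * π)) := by
  rw [obliqueCylinder_eq_preimage hb]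
  rw [← ContinuousLinearEquiv.coe_toHomeomorph, ← Homeomorph.preimage_frontier, frontier_prod_eq,
    Metric.isClosed_closedBall.closure_eq, isClosed_Icc.closure_eq, frontier_Icc hb.le,
    frontier_closedBall _ one_ne_zero, ContinuousLinearEquiv.coe_toHomeomorph,
    liftPlane_image_closedBall, liftPlane_image_closedBall, lateralMap_image_strip hb,
    ← preimage_union, ← preimage_union]
  congr 1
  ext ⟨x, t⟩
  have hsub : x ∈ Metric.sphere (0 : EuclideanSpace ℝ (Fin 2)) 1 → x ∈ Metric.closedBall 0 1 :=
    fun h => Metric.sphere_subset_closedBall h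
  simp only [mem_union, mem_prod, mem_insert_iff, mem_singleton_iff, mem_Icc, mem_Ioo,
    le_iff_lt_or_eq]
  have e : (0 = t) ↔ (t = 0) := eq_comm
  rw [e]
  by_cases h0 : t = 0
  · subst h0
    have := hb.ne
    tauto
  · by_cases h1 : t = b
    · subst h1
      tauto
    · tauto

theorem surfaceArea_obliqueCylinder {a b : ℝ} (hb : 0 < b) :
    surfaceArea (obliqueCylinder a b) =
      ENNReal.ofReal
        (2 * (π + 2 * √(a ^ 2 + b ^ 2) * ellipticE (a ^ 2 / (a ^ 2 + b ^ 2)))) := by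
  have hD : 0 ≤ ∫ θ in (0 : ℝ)..(2 * π), lateralDensity a b θ :=
    intervalIntegral.integral_nonneg Real.two_pi_pos.le fun θ _ => lateralDensity_nonneg a b θ
  have hL : MeasurableSet (lateralMap a b '' strip 0 (2 * π)) :=
    (measurableSet_strip _ _).image_of_continuousOn_injOn
      (continuous_lateralMap a b).continuousOn (injOn_lateralMap hb.ne')
  have hT : MeasurableSet (liftPlane (a / b * b) b '' Metric.closedBall 0 1) :=
    ((isCompact_closedBall _ _).image (isometry_liftPlane _ _).continuous).measurableSet
  rw [surfaceArea, frontier_obliqueCylinder hb, measure_union _ (hT.union hL),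
    measure_union _ hL, area_liftPlane_closedBall, area_liftPlane_closedBall,
    area_lateralMap_strip_eq_integral hb, ← ENNReal.ofReal_add Real.pi_pos.le hD,
    ← ENNReal.ofReal_add Real.pi_pos.le (add_nonneg Real.pi_pos.le hD),
    integral_lateralDensity hb]
  · congr 1
    ring
  · rw [liftPlane_image_closedBall, lateralMap_image_strip hb]
    refine disjoint_left.mpr ?_
    rintro p ⟨-, h1⟩ ⟨-, -, h2⟩
    exact h2.ne h1
  · rw [liftPlane_image_closedBall, liftPlane_image_closedBall, lateralMap_image_strip hb]
    refine disjoint_left.mpr ?_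
    rintro p ⟨-, h1⟩ (⟨-, h2⟩ | ⟨-, h2, -⟩)
    · exact hb.ne (h1.symm.trans h2)
    · exact h2.ne' h1

theorem mainTheorem1 (a b : ℝ) (ha : 0 ≤ a) (hb : 0 < b) :
    MeasureTheory.volume (obliqueCylinder a b) = ENNReal.ofReal (π * b) ∧
    surfaceArea (obliqueCylinder a b) =
      ENNReal.ofReal
        (2 * (π + 2 * √(a ^ 2 + b ^ 2) * ellipticE (a ^ 2 / (a ^ 2 + b ^ 2)))) :=
  ⟨volume_obliqueCylinder hb, surfaceArea_obliqueCylinder hb⟩
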